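/- Let $n\in\mathbb{N}$. Fix a nonnegative $\varphi\in C_c^\infty(\mathbb{R}^n)$ with $\varphi(\xi)=1$ for $|\xi|\le 1/2$ and $\varphi(\xi)=0$ for $|\xi|\ge 1$, put $\psi(\xi)=\varphi(\xi/2)-\varphi(\xi)$, and for $f\in\mathcal{S}'(\mathbb{R}^n)$ and $j\in\mathbb{Z}$ let $\Delta_j f\in\mathcal{S}'(\mathbb{R}^n)$ be defined by $\widehat{\Delta_j f}(\xi)=\psi(2^{-j}\xi)\widehat f(\xi)$. For $s\in\mathbb{R}$ and $q,r\in[1,\infty]$ put $$\|f\|_{\dot B^{s,q}_r}=\Big(\sum_{j\in\mathbb{Z}}2^{jsr}\|\Delta_jf\|_{L^q}^r\Big)^{1/r}\qquad\Big(\sup_{j\in\mathbb{Z}}2^{js}\|\Delta_jf\|_{L^q}\text{ if }r=\infty\Big).$$ For $1<p<\infty$ and a measurable function $g$ on $\mathbb{R}^n$ let $g^*(s)=\inf\{t\ge 0:|\{x:|g(x)|\ge t\}|\le s\}$ and $$\|g\|_{L^{p,r}}=\Big(\int_0^\infty\big(s^{1/p}g^*(s)\big)^r\,\frac{ds}{s}\Big)^{1/r}\qquad\Big(\sup_{s>0}s^{1/p}g^*(s)\text{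 if }r=\infty\Big).$$ Let $\alpha,\beta>0$, let $q_0,q_1\in[1,\infty]$ with $q_0\ne q_1$, let $\theta=\frac{\alpha}{\alpha+\beta}$, $\frac1p=\frac{1-\theta}{q_0}+\frac{\theta}{q_1}$ (so that $1<p<\infty$), and let $r\in[1,\infty]$. Then there is a constant $C$ (not depending on $f$) such that for every $f\in\mathcal{S}'(\mathbb{R}^n)$ with $f=\sum_{j\in\mathbb{Z}}\Delta_jf$ in $\mathcal{S}'(\mathbb{R}^n)$, $\|f\|_{\dot B^{\alpha,q_0}_r}<\infty$ and $\|f\|_{\dot B^{-\beta,q_1}_r}<\infty$, the distribution $f$ is a function belonging to $L^{p,r}(\mathbb{R}^n)$ and $$\|f\|_{L^{p,r}}\le C\,\|f\|_{\dot B^{\alpha,q_0}_r}^{1-\theta}\,\|f\|_{\dot B^{-\beta,q_1}_r}^{\theta}.$$ -/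

import Mathlib

open MeasureTheory Filter Topology
open scoped ENNReal NNReal SchwartzMap

noncomputable section

namespace RefinedSobolev

/-- A Littlewood-Paley cut-off on `ℝⁿ`: a nonnegative test function, equal to `1` on
`|ξ| ≤ 1/2` and to `0` on `|ξ| ≥ 1` (so that its support is automatically compact). -/
structure IsCutoff {n : ℕ} (φ : EuclideanSpace ℝ (Fin n) → ℝ) : Prop where
  smooth : ContDiff ℝ (⊤ : ℕ∞) φ
  nonneg : ∀ ξ, 0 ≤ φ ξ
  eq_one : ∀ ξ, ‖ξ‖ ≤ 1 / 2 → φ ξ = 1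
  eq_zero : ∀ ξ, 1 ≤ ‖ξ‖ → φ ξ = 0

/-- `ψ(ξ) = φ(ξ/2) - φ(ξ)`. -/
def annulus {n : ℕ} (φ : EuclideanSpace ℝ (Fin n) → ℝ) (ξ : EuclideanSpace ℝ (Fin n)) : ℝ :=
  φ ((1 / 2 : ℝ) • ξ) - φ ξ

/-- The dyadic block `Δ_j f`: the tempered distribution whose Fourier transform is
`ψ(2^{-j} ξ)` times the Fourier transform of `f`. -/
def dyadicBlock {n : ℕ} (φ : EuclideanSpace ℝ (Fin n) → ℝ) (j : ℤ)
    (f : 𝓢'(EuclideanSpace ℝ (Fin n), ℂ)) : 𝓢'(EuclideanSpace ℝ (Fin n), ℂ) :=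
  TemperedDistribution.fourierMultiplierCLM ℂ
    (fun ξ => ((annulus φ (((2 : ℝ) ^ (-j)) • ξ) : ℝ) : ℂ)) f

/-- `f` has the homogeneous Littlewood-Paley decomposition `f = ∑_{j ∈ ℤ} Δ_j f`, the series
converging in the sense of tempered distributions. -/
def HasLittlewoodPaley {n : ℕ} (φ : EuclideanSpace ℝ (Fin n) → ℝ)
    (f : 𝓢'(EuclideanSpace ℝ (Fin n), ℂ)) : Prop :=
  Tendsto (fun N : ℕ => ∑ j ∈ Finset.Icc (-(N : ℤ)) (N : ℤ), dyadicBlock φ j f) atTop (𝓝 f)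

/-- The tempered distribution `f` is the function `g`. -/
def IsFunction {n : ℕ} (f : 𝓢'(EuclideanSpace ℝ (Fin n), ℂ))
    (g : EuclideanSpace ℝ (Fin n) → ℂ) : Prop :=
  AEStronglyMeasurable g volume ∧
    ∀ u : 𝓢(EuclideanSpace ℝ (Fin n), ℂ),
      Integrable (fun x => u x * g x) volume ∧ f u = ∫ x, u x * g x

/-- The `L^p` norm of a tempered distribution; it is `∞` if the distribution is not a function.
The function `g` is unique up to null sets, so the infimum has at most one value. -/
def distLpNorm {n : ℕ} (p : ℝ≥0∞) (f : 𝓢'(EuclideanSpace ℝ (Fin n), ℂ)) : ℝ≥0∞ :=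
  ⨅ (g : EuclideanSpace ℝ (Fin n) → ℂ) (_ : IsFunction f g), eLpNorm g p volume

/-- The homogeneous Besov semi-norm of `Ḃ^{s,p}_q`: the `ℓ^q` norm over `j ∈ ℤ` of
`2^{js} ‖Δ_j f‖_{L^p}`. -/
def besovNorm {n : ℕ} (φ : EuclideanSpace ℝ (Fin n) → ℝ) (s : ℝ) (p q : ℝ≥0∞)
    (f : 𝓢'(EuclideanSpace ℝ (Fin n), ℂ)) : ℝ≥0∞ :=
  if q = ⊤ then ⨆ j : ℤ, (2 : ℝ≥0∞) ^ ((j : ℝ) * s) * distLpNorm p (dyadicBlock φ j f)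
  else (∑' j : ℤ, ((2 : ℝ≥0∞) ^ ((j : ℝ) * s) * distLpNorm p (dyadicBlock φ j f)) ^ q.toReal)
    ^ (1 / q.toReal)

/-- The distribution function `d_g(t) = μ {|g| ≥ t}`. -/
def distribution {X : Type*} [MeasurableSpace X] (μ : Measure X) (g : X → ℂ) (t : ℝ≥0∞) : ℝ≥0∞ :=
  μ {x | t ≤ ‖g x‖ₑ}

/-- The nonincreasing rearrangement `g^*(s) = inf {t ≥ 0 : d_g(t) ≤ s}`. -/
def rearrangement {X : Type*} [MeasurableSpace X] (μ : Measure X) (g : X → ℂ) (s : ℝ≥0∞) : ℝ≥0∞ :=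
  sInf {t : ℝ≥0∞ | distribution μ g t ≤ s}

/-- The Lorentz (quasi-)norm `‖g‖_{L^{p,r}} = (∫_0^∞ (s^{1/p} g^*(s))^r ds/s)^{1/r}`, and
`sup_{s > 0} s^{1/p} g^*(s)` if `r = ∞`. -/
def lorentzNorm {X : Type*} [MeasurableSpace X] (μ : Measure X) (p : ℝ) (r : ℝ≥0∞) (g : X → ℂ) :
    ℝ≥0∞ :=
  if r = ⊤ then
    ⨆ (s : ℝ) (_ : 0 < s), ENNReal.ofReal s ^ (1 / p) * rearrangement μ g (ENNReal.ofReal s)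
  else
    (∫⁻ s in Set.Ioi (0 : ℝ),
      (ENNReal.ofReal s ^ (1 / p) * rearrangement μ g (ENNReal.ofReal s)) ^ r.toReal
        / ENNReal.ofReal s) ^ (1 / r.toReal)

end RefinedSobolev

end

/-!
The inequality is real interpolation by the `J`-method, carried out by hand for the dyadic blocks.

Finiteness of the two Besov norms makes every `Δ_j f` a function `F_j`, unique up to null sets
(`IsFunction.ae_eq`), with `a_j = 2^{jα} ‖F_j‖_{q₀}` and `b_j = 2^{-jβ} ‖F_j‖_{q₁}` in `ℓ^r`, hence
bounded. By the geometric weights `∑_{j > N} F_j` converges absolutely in `L^{q₀}` and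
`∑_{j ≤ N} F_j` in `L^{q₁}`, for every `N`. So `∑ |F_j|` is finite almost everywhere and can be
integrated against Schwartz functions, and dominated convergence identifies `f` with the pointwise
sum `g = ∑ F_j` (`isFunction_tsum`).

For the bound, Chebyshev's inequality for the two parts of the series gives
`g^*(s) ≤ 4 (s^{-1/q₀} ∑_{j > N} ‖F_j‖_{q₀} + s^{-1/q₁} ∑_{j ≤ N} ‖F_j‖_{q₁})` for all `s` and `N`
(`rearrangement_le`). With `δ = 1/q₁ - 1/q₀ ≠ 0` one has `1/p - 1/q₀ = θδ` and
`1/p - 1/q₁ = -(1-θ)δ`. Choosing `N = N(s)` by `s^δ ≈ l 2^{N(α+β)}` turns the estimate into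
`s^{1/p} g^*(s) ≲ l^θ ∑_{k ≥ 0} 2^{-αk} a_{N+1+k} + l^{θ-1} ∑_{k ≥ 0} 2^{-βk} b_{N-k}`.
The sets of `s` with a given `N(s)` have bounded `ds/s`-mass (`lorentzNorm_le_of_floor_log`), so
Young's inequality on `ℤ` (`eLpNorm_count_tsum_mul_le`) bounds the Lorentz norm by
`l^θ ‖a‖ + l^{θ-1} ‖b‖`, and `l = ‖b‖ / ‖a‖` gives both terms the same size.
-/

namespace RefinedSobolev

/-! ### Weak-type bounds, rearrangements and discretized Lorentz norms -/

section Measure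
variable {X : Type*} [MeasurableSpace X] {μ : Measure X}

/-- Minkowski's inequality for a countable sum of nonnegative functions. -/
theorem eLpNorm_tsum_le {F : ℕ → X → ℝ≥0∞} (hF : ∀ i, AEMeasurable (F i) μ) {p : ℝ≥0∞}
    (hp : 1 ≤ p) : eLpNorm (fun x => ∑' i, F i x) p μ ≤ ∑' i, eLpNorm (F i) p μ := by
  rcases eq_or_ne p ⊤ with rfl | hpt
  · simp only [eLpNorm_exponent_top]
    refine essSup_le_of_ae_le _ ?_
    filter_upwards [ae_all_iff.2 fun i => enorm_ae_le_eLpNormEssSup (F i) μ] with x hx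
    simp only [enorm_eq_self] at hx ⊢
    exact ENNReal.tsum_le_tsum hx
  · have hp0 : p ≠ 0 := (zero_lt_one.trans_le hp).ne'
    have hp' : 0 < p.toReal := ENNReal.toReal_pos hp0 hpt
    rw [eLpNorm_eq_lintegral_rpow_enorm_toReal hp0 hpt, one_div, ENNReal.rpow_inv_le_iff hp']
    simp only [enorm_eq_self]
    have hlim := lintegral_tendsto_of_tendsto_of_monotone (μ := μ)
      (f := fun n x => (∑ i ∈ Finset.range n, F i x) ^ p.toReal)
      (F := fun x => (∑' i, F i x) ^ p.toReal)
      (fun n => (Finset.aemeasurable_fun_sum _ fun i _ => hF i).pow_const _)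
      (Eventually.of_forall fun x m n hmn => by
        dsimp only
        gcongr)
      (Eventually.of_forall fun x =>
        (ENNReal.continuous_rpow_const.tendsto _).comp (ENNReal.tendsto_nat_tsum fun i => F i x))
    refine le_of_tendsto' hlim fun n => ?_
    have h := eLpNorm_sum_le (μ := μ) (p := p) (s := Finset.range n) (f := F)
      (fun i _ => (hF i).aestronglyMeasurable) hp
    rw [eLpNorm_eq_lintegral_rpow_enorm_toReal hp0 hpt, one_div] at h
    have h' := (ENNReal.rpow_inv_le_iff hp').1 (h.trans (ENNReal.sum_le_tsum _))
    simpa only [enorm_eq_self, Finset.sum_apply] using h'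

theorem ae_lt_top_of_eLpNorm_lt_top {G : X → ℝ≥0∞} (hG : AEMeasurable G μ) {q : ℝ≥0∞}
    (hq : q ≠ 0) (h : eLpNorm G q μ < ⊤) : ∀ᵐ x ∂μ, G x < ⊤ := by
  rcases eq_or_ne q ⊤ with rfl | hqt
  · filter_upwards [enorm_ae_le_eLpNormEssSup G μ] with x hx
    rw [enorm_eq_self, ← eLpNorm_exponent_top] at hx
    exact hx.trans_lt h
  · have hfin := lintegral_rpow_enorm_lt_top_of_eLpNorm_lt_top hq hqt h
    filter_upwards [ae_lt_top' (by simpa using hG.pow_const _) hfin.ne] with x hx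
    simp only [enorm_eq_self] at hx
    exact (ENNReal.rpow_lt_top_iff_of_pos (ENNReal.toReal_pos hq hqt)).1 hx

/-- Chebyshev's inequality at level `s / 2`, uniformly in `q ∈ [1, ∞]`: here `(q⁻¹).toReal` is
`1/q`, which is `0` for `q = ∞`. The factor `2` absorbs `2 ^ (1/q)`. -/
theorem measure_le_half_of_eLpNorm_lt {G : X → ℝ≥0∞} (hG : AEMeasurable G μ) {q : ℝ≥0∞}
    (hq : 1 ≤ q) {s t : ℝ≥0∞} (hs : s ≠ 0) (hs' : s ≠ ⊤)
    (ht : 2 * (s ^ (-(q⁻¹).toReal) * eLpNorm G q μ) < t) : μ {x | t ≤ G x} ≤ s / 2 := by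
  rcases eq_or_ne q ⊤ with rfl | hqt
  · have h : eLpNorm G ⊤ μ < t := by
      refine lt_of_le_of_lt ?_ ht
      simp only [ENNReal.inv_top, ENNReal.toReal_zero, neg_zero, ENNReal.rpow_zero, one_mul]
      exact le_mul_of_one_le_left' (by norm_num)
    have h0 : μ {x | t ≤ G x} = 0 := by
      rw [measure_eq_zero_iff_ae_notMem]
      filter_upwards [enorm_ae_le_eLpNormEssSup G μ] with x hx
      rw [enorm_eq_self, ← eLpNorm_exponent_top] at hx
      simpa using hx.trans_lt h
    simp [h0]
  · have hq0 : q ≠ 0 := (zero_lt_one.trans_le hq).ne'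
    have hq' : 0 < q.toReal := ENNReal.toReal_pos hq0 hqt
    have hq1 : 1 ≤ q.toReal := by
      simpa using (ENNReal.toReal_le_toReal ENNReal.one_ne_top hqt).2 hq
    have hA : eLpNorm G q μ ≠ ⊤ := by
      intro h
      rw [h, ENNReal.mul_top, ENNReal.mul_top two_ne_zero] at ht
      · exact not_top_lt ht
      · exact (ENNReal.rpow_pos (pos_iff_ne_zero.2 hs) hs').ne'
    rcases eq_or_ne t ⊤ with rfl | htt
    · have h0 : μ {x | ⊤ ≤ G x} = 0 := by
        rw [measure_eq_zero_iff_ae_notMem]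
        filter_upwards [ae_lt_top_of_eLpNorm_lt_top hG hq0 hA.lt_top] with x hx
        simpa using hx.ne
      exact h0.trans_le bot_le
    have hcheb := mul_meas_ge_le_pow_eLpNorm' μ hq0 hqt hG.aestronglyMeasurable t
    simp only [enorm_eq_self] at hcheb
    have ht0 : t ≠ 0 := (bot_le.trans_lt ht).ne'
    -- `t^q` dominates `2 A^q / s`, as `2 ≤ 2^q`.
    have hpow : 2 * (s⁻¹ * eLpNorm G q μ ^ q.toReal) ≤ t ^ q.toReal := by
      calc 2 * (s⁻¹ * eLpNorm G q μ ^ q.toReal)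
          ≤ 2 ^ q.toReal * (s⁻¹ * eLpNorm G q μ ^ q.toReal) := by
            gcongr
            simpa using ENNReal.rpow_le_rpow_of_exponent_le (x := 2) (by norm_num) hq1
        _ = (2 * (s ^ (-(q⁻¹).toReal) * eLpNorm G q μ)) ^ q.toReal := by
            rw [ENNReal.mul_rpow_of_nonneg _ _ hq'.le, ENNReal.mul_rpow_of_nonneg _ _ hq'.le,
              ← ENNReal.rpow_mul, ENNReal.toReal_inv, neg_mul, inv_mul_cancel₀ hq'.ne',
              ENNReal.rpow_neg_one]
        _ ≤ t ^ q.toReal := by gcongr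
    have htq : t ^ q.toReal ≠ 0 := (ENNReal.rpow_pos (pos_iff_ne_zero.2 ht0) htt).ne'
    have htq' : t ^ q.toReal ≠ ⊤ := ENNReal.rpow_ne_top_of_nonneg hq'.le htt
    rw [← ENNReal.mul_le_mul_iff_right htq htq']
    refine hcheb.trans ?_
    calc eLpNorm G q μ ^ q.toReal
        = 2 * (s⁻¹ * eLpNorm G q μ ^ q.toReal) * (s / 2) := by
          rw [show 2 * (s⁻¹ * eLpNorm G q μ ^ q.toReal) * (s / 2)
            = (2 * 2⁻¹) * (s⁻¹ * s) * eLpNorm G q μ ^ q.toReal by rw [div_eq_mul_inv]; ring,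
            ENNReal.mul_inv_cancel two_ne_zero ENNReal.ofNat_ne_top, ENNReal.inv_mul_cancel hs hs']
          simp
      _ ≤ t ^ q.toReal * (s / 2) := by gcongr

/-- If `|g| ≤ G₀ + G₁`, then `g^*(s)` is at most the sum of the weak-type bounds of `G₀ ∈ L^{q₀}`
and `G₁ ∈ L^{q₁}`: above that level one of the two exceeds half of it, and each does so on a set of
measure at most `s / 2`. -/
theorem rearrangement_le {g : X → ℂ} {G₀ G₁ : X → ℝ≥0∞} (hG₀ : AEMeasurable G₀ μ)
    (hG₁ : AEMeasurable G₁ μ) (hg : ∀ᵐ x ∂μ, ‖g x‖ₑ ≤ G₀ x + G₁ x) {q₀ q₁ : ℝ≥0∞}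
    (hq₀ : 1 ≤ q₀) (hq₁ : 1 ≤ q₁) {s : ℝ≥0∞} (hs : s ≠ 0) (hs' : s ≠ ⊤) :
    rearrangement μ g s ≤
      4 * (s ^ (-(q₀⁻¹).toReal) * eLpNorm G₀ q₀ μ + s ^ (-(q₁⁻¹).toReal) * eLpNorm G₁ q₁ μ) := by
  refine le_of_forall_gt fun t ht => ?_
  obtain ⟨t', ht', ht't⟩ := exists_between ht
  refine lt_of_le_of_lt (sInf_le ?_) ht't
  have hsplit : (4 : ℝ≥0∞) * (s ^ (-(q₀⁻¹).toReal) * eLpNorm G₀ q₀ μ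
      + s ^ (-(q₁⁻¹).toReal) * eLpNorm G₁ q₁ μ) / 2
      = 2 * (s ^ (-(q₀⁻¹).toReal) * eLpNorm G₀ q₀ μ
        + s ^ (-(q₁⁻¹).toReal) * eLpNorm G₁ q₁ μ) := by
    rw [show (4 : ℝ≥0∞) = 2 * 2 by norm_num, div_eq_mul_inv, mul_comm, ← mul_assoc, ← mul_assoc,
      ENNReal.inv_mul_cancel two_ne_zero ENNReal.ofNat_ne_top, one_mul]
  have hhalf : 2 * (s ^ (-(q₀⁻¹).toReal) * eLpNorm G₀ q₀ μ
      + s ^ (-(q₁⁻¹).toReal) * eLpNorm G₁ q₁ μ) < t' / 2 := by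
    rw [← hsplit]
    exact ENNReal.div_lt_div_right two_ne_zero ENNReal.ofNat_ne_top ht'
  have h₀ := measure_le_half_of_eLpNorm_lt hG₀ hq₀ hs hs'
    (lt_of_le_of_lt (by gcongr; exact le_self_add) hhalf)
  have h₁ := measure_le_half_of_eLpNorm_lt hG₁ hq₁ hs hs'
    (lt_of_le_of_lt (by gcongr; exact le_add_self) hhalf)
  calc μ {x | t' ≤ ‖g x‖ₑ} ≤ μ ({x | t' / 2 ≤ G₀ x} ∪ {x | t' / 2 ≤ G₁ x}) := by
        refine measure_mono_ae ?_
        filter_upwards [hg] with x hx (hxt : t' ≤ ‖g x‖ₑ)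
        by_contra hcon
        have hcon' : ¬ (t' / 2 ≤ G₀ x ∨ t' / 2 ≤ G₁ x) := hcon
        push Not at hcon'
        have := (hxt.trans hx).trans_lt (ENNReal.add_lt_add hcon'.1 hcon'.2)
        rw [ENNReal.add_halves] at this
        exact lt_irrefl _ this
    _ ≤ s / 2 + s / 2 := (measure_union_le _ _).trans (add_le_add h₀ h₁)
    _ = s := ENNReal.add_halves s

/-- For the measure `ds/s`, the cells `{s > 0 : ⌊a log s + b⌋ = k}` have uniformly bounded mass.
Their mass is `1/|a|`; the cruder bound `exp (1/|a|)` needs no integration of `1/s`. -/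
theorem lintegral_inv_floor_log_le {a b : ℝ} (ha : a ≠ 0) (k : ℤ) :
    ∫⁻ s in Set.Ioi (0 : ℝ) ∩ {s | ⌊a * Real.log s + b⌋ = k}, (ENNReal.ofReal s)⁻¹
      ≤ ENNReal.ofReal (Real.exp |a|⁻¹) := by
  obtain ⟨x, hx⟩ : ∃ x, ∀ s : ℝ, ⌊a * Real.log s + b⌋ = k →
      x ≤ Real.log s ∧ Real.log s ≤ x + |a|⁻¹ := by
    rcases ha.lt_or_gt with h | h
    · refine ⟨(k + 1 - b) / a, fun s hs => ?_⟩
      obtain ⟨h1, h2⟩ := Int.floor_eq_iff.1 hs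
      rw [abs_of_neg h]
      constructor
      · rw [div_le_iff_of_neg h]; linarith
      · rw [show (k + 1 - b) / a + (-a)⁻¹ = (k - b) / a by field_simp; ring, le_div_iff_of_neg h]
        linarith
    · refine ⟨(k - b) / a, fun s hs => ?_⟩
      obtain ⟨h1, h2⟩ := Int.floor_eq_iff.1 hs
      rw [abs_of_pos h]
      constructor
      · rw [div_le_iff₀ h]; linarith
      · rw [show (k - b) / a + a⁻¹ = (k + 1 - b) / a by field_simp; ring, le_div_iff₀ h]
        linarith
  have hsub : Set.Ioi (0 : ℝ) ∩ {s | ⌊a * Real.log s + b⌋ = k}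
      ⊆ Set.Icc (Real.exp x) (Real.exp (x + |a|⁻¹)) := fun s hs =>
    ⟨(Real.le_log_iff_exp_le hs.1).1 (hx s hs.2).1, (Real.log_le_iff_le_exp hs.1).1 (hx s hs.2).2⟩
  calc _ ≤ ∫⁻ s in Set.Icc (Real.exp x) (Real.exp (x + |a|⁻¹)), (ENNReal.ofReal s)⁻¹ :=
        lintegral_mono_set hsub
    _ ≤ ∫⁻ s in Set.Icc (Real.exp x) (Real.exp (x + |a|⁻¹)), (ENNReal.ofReal (Real.exp x))⁻¹ := by
        refine setLIntegral_mono' measurableSet_Icc fun s hs => ?_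
        exact ENNReal.inv_le_inv.2 (ENNReal.ofReal_le_ofReal hs.1)
    _ = ENNReal.ofReal ((Real.exp x)⁻¹ * (Real.exp (x + |a|⁻¹) - Real.exp x)) := by
        rw [setLIntegral_const, Real.volume_Icc, ENNReal.ofReal_mul (by positivity),
          ENNReal.ofReal_inv_of_pos (Real.exp_pos x)]
    _ ≤ ENNReal.ofReal (Real.exp |a|⁻¹) := by
        refine ENNReal.ofReal_le_ofReal ?_
        rw [Real.exp_add, show (Real.exp x)⁻¹ * (Real.exp x * Real.exp |a|⁻¹ - Real.exp x)
          = Real.exp |a|⁻¹ - 1 by field_simp]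
        linarith

/-- Discretization of the Lorentz norm: if `s^{1/p} g^*(s)` is bounded by a sequence evaluated at
the index `⌊a log s + b⌋`, then the Lorentz norm is bounded by the `ℓ^r` norm of the sequence. For
`r = ∞` the exponent `1 / r.toReal` is `0`, so the constant is `1`. -/
theorem lorentzNorm_le_of_floor_log {a b : ℝ} (ha : a ≠ 0) {p : ℝ} {r : ℝ≥0∞} (hr : 1 ≤ r)
    {g : X → ℂ} {H : ℤ → ℝ≥0∞}
    (h : ∀ s : ℝ, 0 < s → ENNReal.ofReal s ^ (1 / p) * rearrangement μ g (ENNReal.ofReal s)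
      ≤ H ⌊a * Real.log s + b⌋) :
    lorentzNorm μ p r g
      ≤ ENNReal.ofReal (Real.exp |a|⁻¹) ^ (1 / r.toReal) * eLpNorm H r Measure.count := by
  unfold lorentzNorm
  split_ifs with hrt
  · subst hrt
    simp only [ENNReal.toReal_top, div_zero, ENNReal.rpow_zero, one_mul, eLpNorm_exponent_top,
      eLpNormEssSup_count, enorm_eq_self]
    exact iSup₂_le fun s hs => (h s hs).trans (le_iSup H _)
  · have hr0 : r ≠ 0 := (zero_lt_one.trans_le hr).ne'
    have hr' : 0 < r.toReal := ENNReal.toReal_pos hr0 hrt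
    rw [eLpNorm_eq_lintegral_rpow_enorm_toReal hr0 hrt,
      ← ENNReal.mul_rpow_of_nonneg _ _ (by positivity)]
    gcongr
    simp only [enorm_eq_self, lintegral_count]
    have hmeas : Measurable fun s : ℝ => ⌊a * Real.log s + b⌋ :=
      ((Real.measurable_log.const_mul a).add_const b).floor
    have hset : ∀ k : ℤ, MeasurableSet
        (Set.Ioi (0 : ℝ) ∩ {s | ⌊a * Real.log s + b⌋ = k}) := fun k =>
      measurableSet_Ioi.inter (hmeas (measurableSet_singleton k))
    have hun : Set.Ioi (0 : ℝ) = ⋃ k : ℤ, Set.Ioi (0 : ℝ) ∩ {s | ⌊a * Real.log s + b⌋ = k} := by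
      ext s; simp
    rw [hun, ← ENNReal.tsum_mul_left]
    refine (lintegral_iUnion_le _ _).trans (ENNReal.tsum_le_tsum fun k => ?_)
    calc _ ≤ ∫⁻ s in Set.Ioi (0 : ℝ) ∩ {s | ⌊a * Real.log s + b⌋ = k},
            H k ^ r.toReal * (ENNReal.ofReal s)⁻¹ := by
          refine setLIntegral_mono' (hset k) fun s hs => ?_
          rw [div_eq_mul_inv]
          gcongr
          exact (h s hs.1).trans_eq (by rw [hs.2])
      _ = H k ^ r.toReal * ∫⁻ s in Set.Ioi (0 : ℝ) ∩ {s | ⌊a * Real.log s + b⌋ = k},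
            (ENNReal.ofReal s)⁻¹ :=
          lintegral_const_mul _ ENNReal.measurable_ofReal.inv
      _ ≤ _ := by
          rw [mul_comm]
          gcongr
          exact lintegral_inv_floor_log_le ha k

/-- Young's inequality `ℓ¹ * ℓ^r ⊆ ℓ^r` on `ℤ`, with the shifts given as permutations `e k` of `ℤ`.
-/
theorem eLpNorm_count_tsum_mul_le {r : ℝ≥0∞} (hr : 1 ≤ r) (w : ℕ → ℝ≥0∞) (a : ℤ → ℝ≥0∞)
    (e : ℕ → ℤ ≃ ℤ) :
    eLpNorm (fun N => ∑' k, w k * a (e k N)) r Measure.count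
      ≤ (∑' k, w k) * eLpNorm a r Measure.count := by
  refine (eLpNorm_tsum_le (fun i => (measurable_of_countable _).aemeasurable) hr).trans ?_
  rw [← ENNReal.tsum_mul_right]
  refine ENNReal.tsum_le_tsum fun k => ?_
  rcases eq_or_ne r ⊤ with rfl | hrt
  · simp only [eLpNorm_exponent_top, eLpNormEssSup_count, enorm_eq_self, ← ENNReal.mul_iSup]
    rw [(e k).iSup_comp (g := a)]
  · have hr0 : r ≠ 0 := (zero_lt_one.trans_le hr).ne'
    have hr' : 0 < r.toReal := ENNReal.toReal_pos hr0 hrt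
    simp only [eLpNorm_eq_lintegral_rpow_enorm_toReal hr0 hrt, lintegral_count, enorm_eq_self,
      ENNReal.mul_rpow_of_nonneg _ _ hr'.le, ENNReal.tsum_mul_left]
    rw [(e k).tsum_eq (fun j => a j ^ r.toReal), ENNReal.mul_rpow_of_nonneg _ _ (by positivity),
      ← ENNReal.rpow_mul, mul_one_div_cancel hr'.ne', ENNReal.rpow_one]

end Measure

/-! ### Tempered distributions that are functions -/

section Distribution
variable {n : ℕ}

theorem IsFunction.locallyIntegrable {f : 𝓢'(EuclideanSpace ℝ (Fin n), ℂ)}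
    {g : EuclideanSpace ℝ (Fin n) → ℂ} (h : IsFunction f g) : LocallyIntegrable g volume := by
  intro x
  let u : ContDiffBump x := ⟨1, 2, one_pos, one_lt_two⟩
  have hc : HasCompactSupport fun y => (u y : ℂ) :=
    u.hasCompactSupport.comp_left (g := ((↑) : ℝ → ℂ)) (by simp)
  have hu : ContDiff ℝ (⊤ : ℕ∞) fun y => (u y : ℂ) := Complex.ofRealCLM.contDiff.comp u.contDiff
  refine ⟨Metric.closedBall x 1, Metric.closedBall_mem_nhds x one_pos, ?_⟩
  have hi := (h.2 (hc.toSchwartzMap hu)).1.integrableOn (s := Metric.closedBall x 1)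
  refine hi.congr_fun (fun y hy => ?_) Metric.isClosed_closedBall.measurableSet
  have h1 : u y = 1 := u.one_of_mem_closedBall hy
  simp [h1]

theorem IsFunction.ae_eq {f : 𝓢'(EuclideanSpace ℝ (Fin n), ℂ)}
    {g g' : EuclideanSpace ℝ (Fin n) → ℂ} (h : IsFunction f g) (h' : IsFunction f g') :
    g =ᵐ[volume] g' := by
  refine ae_eq_of_integral_contDiff_smul_eq h.locallyIntegrable h'.locallyIntegrable
    fun u hu hc => ?_
  have hc' : HasCompactSupport fun x => (u x : ℂ) := hc.comp_left (g := ((↑) : ℝ → ℂ)) (by simp)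
  have hu' : ContDiff ℝ (⊤ : ℕ∞) fun x => (u x : ℂ) := Complex.ofRealCLM.contDiff.comp hu
  have e := ((h.2 (hc'.toSchwartzMap hu')).2).symm.trans (h'.2 (hc'.toSchwartzMap hu')).2
  simpa [Complex.real_smul] using e

/-- As the representing function is unique almost everywhere, the same function computes the `L^p`
norm of the distribution for every `p`. -/
theorem IsFunction.distLpNorm_eq {f : 𝓢'(EuclideanSpace ℝ (Fin n), ℂ)}
    {g : EuclideanSpace ℝ (Fin n) → ℂ} (h : IsFunction f g) (p : ℝ≥0∞) :
    distLpNorm p f = eLpNorm g p volume :=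
  le_antisymm (iInf₂_le g h) (le_iInf₂ fun _ h' => (eLpNorm_congr_ae (h.ae_eq h')).le)

theorem exists_isFunction_of_distLpNorm_lt_top {f : 𝓢'(EuclideanSpace ℝ (Fin n), ℂ)} {p : ℝ≥0∞}
    (h : distLpNorm p f < ⊤) : ∃ g, IsFunction f g := by
  simp only [distLpNorm, iInf_lt_iff] at h
  obtain ⟨g, hg, -⟩ := h
  exact ⟨g, hg⟩

/-- Absolutely convergent series in `L^q` may be paired with Schwartz functions, by Hölder's
inequality. -/
theorem lintegral_enorm_mul_tsum_lt_top {F : ℕ → EuclideanSpace ℝ (Fin n) → ℂ}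
    (hF : ∀ k, AEStronglyMeasurable (F k) volume) {q : ℝ≥0∞} (hq : 1 ≤ q)
    (h : ∑' k, eLpNorm (F k) q volume < ⊤) (u : 𝓢(EuclideanSpace ℝ (Fin n), ℂ)) :
    ∫⁻ x, ‖u x‖ₑ * ∑' k, ‖F k x‖ₑ < ⊤ := by
  have hconj := ENNReal.HolderConjugate.conjExponent hq
  have hu : AEStronglyMeasurable u volume := u.continuous.aestronglyMeasurable
  calc ∫⁻ x, ‖u x‖ₑ * ∑' k, ‖F k x‖ₑ = ∑' k, eLpNorm (⇑u • F k) 1 volume := by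
        simp_rw [← ENNReal.tsum_mul_left]
        rw [lintegral_tsum (f := fun k x => ‖u x‖ₑ * ‖F k x‖ₑ) fun k => hu.enorm.mul (hF k).enorm]
        simp [eLpNorm_one_eq_lintegral_enorm, enorm_mul]
    _ ≤ ∑' k, eLpNorm (⇑u) q.conjExponent volume * eLpNorm (F k) q volume := by
        refine ENNReal.tsum_le_tsum fun k => ?_
        have := hconj.symm
        exact eLpNorm_smul_le_mul_eLpNorm (hF k) hu
    _ < ⊤ := by
        rw [ENNReal.tsum_mul_left]
        exact ENNReal.mul_lt_top (SchwartzMap.memLp u q.conjExponent volume).2 h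

/-- A series of functions that converges in the sense of distributions, and is dominated by an
integrable function after multiplication by any Schwartz function, represents its distributional sum
by its pointwise sum. -/
theorem isFunction_tsum {T : ℤ → 𝓢'(EuclideanSpace ℝ (Fin n), ℂ)}
    {F : ℤ → EuclideanSpace ℝ (Fin n) → ℂ} (hF : ∀ j, IsFunction (T j) (F j))
    {f : 𝓢'(EuclideanSpace ℝ (Fin n), ℂ)}
    (hf : Tendsto (fun N : ℕ => ∑ j ∈ Finset.Icc (-(N : ℤ)) (N : ℤ), T j) atTop (𝓝 f))
    (hfin : ∀ᵐ x : EuclideanSpace ℝ (Fin n), ∑' j, ‖F j x‖ₑ < ⊤)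
    (hint : ∀ u : 𝓢(EuclideanSpace ℝ (Fin n), ℂ), ∫⁻ x, ‖u x‖ₑ * ∑' j, ‖F j x‖ₑ < ⊤) :
    IsFunction f fun x => ∑' j, F j x := by
  have hmeas : ∀ N : ℕ, AEStronglyMeasurable
      (fun x => ∑ j ∈ Finset.Icc (-(N : ℤ)) (N : ℤ), F j x) volume := fun N =>
    Finset.aestronglyMeasurable_fun_sum _ fun j _ => (hF j).1
  have hlim : ∀ᵐ x : EuclideanSpace ℝ (Fin n), Tendsto
      (fun N : ℕ => ∑ j ∈ Finset.Icc (-(N : ℤ)) (N : ℤ), F j x) atTop (𝓝 (∑' j, F j x)) := by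
    filter_upwards [hfin] with x hx
    have hs : Summable fun j => F j x := by
      refine Summable.of_nnnorm (ENNReal.tsum_coe_ne_top_iff_summable.1 ?_)
      exact hx.ne
    have h := hs.hasSum.mono_left
      (SummationFilter.LeAtTop.le_atTop (L := SummationFilter.symmetricIcc ℤ))
    rw [SummationFilter.symmetricIcc_eq_map_Icc_nat] at h
    exact tendsto_map'_iff.1 h
  have hg : AEStronglyMeasurable (fun x => ∑' j, F j x) volume :=
    aestronglyMeasurable_of_tendsto_ae atTop hmeas hlim
  have hbound : ∀ x, ∀ s : Finset ℤ, ‖∑ j ∈ s, F j x‖ₑ ≤ ∑' j, ‖F j x‖ₑ := fun x s =>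
    (enorm_sum_le _ _).trans (ENNReal.sum_le_tsum s)
  have hGm : AEMeasurable (fun x => ∑' j, ‖F j x‖ₑ) volume :=
    AEMeasurable.tsum fun j => (hF j).1.enorm
  refine ⟨hg, fun u => ?_⟩
  have hu : AEStronglyMeasurable u volume := u.continuous.aestronglyMeasurable
  have hB : Integrable (fun x => (‖u x‖ₑ * ∑' j, ‖F j x‖ₑ).toReal) volume :=
    integrable_toReal_of_lintegral_ne_top (hu.enorm.mul hGm) (hint u).ne
  have hle : ∀ N : ℕ, ∀ᵐ x : EuclideanSpace ℝ (Fin n),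
      ‖u x * ∑ j ∈ Finset.Icc (-(N : ℤ)) (N : ℤ), F j x‖
        ≤ (‖u x‖ₑ * ∑' j, ‖F j x‖ₑ).toReal := fun N => by
    filter_upwards [hfin] with x hx
    rw [← toReal_enorm, enorm_mul]
    refine ENNReal.toReal_mono (ENNReal.mul_ne_top enorm_ne_top hx.ne) ?_
    gcongr
    exact hbound x _
  have hlim' : ∀ᵐ x : EuclideanSpace ℝ (Fin n), Tendsto
      (fun N : ℕ => u x * ∑ j ∈ Finset.Icc (-(N : ℤ)) (N : ℤ), F j x) atTop
      (𝓝 (u x * ∑' j, F j x)) := by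
    filter_upwards [hlim] with x hx using hx.const_mul _
  refine ⟨hB.mono' (hu.mul hg) ?_, ?_⟩
  · filter_upwards [hlim', ae_all_iff.2 hle] with x hx hx'
    exact le_of_tendsto hx.norm (Eventually.of_forall hx')
  · refine tendsto_nhds_unique
      (((PointwiseConvergenceCLM.evalCLM (RingHom.id ℂ) ℂ u).continuous.tendsto f).comp hf) ?_
    have := tendsto_integral_of_dominated_convergence _ (fun N => hu.mul (hmeas N)) hB hle hlim'
    refine this.congr fun N => ?_
    have e : (⇑u * fun x => ∑ j ∈ Finset.Icc (-(N : ℤ)) (N : ℤ), F j x)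
        = fun x => ∑ j ∈ Finset.Icc (-(N : ℤ)) (N : ℤ), u x * F j x := by
      ext x
      exact Finset.mul_sum _ _ _
    rw [e, integral_finsetSum _ fun j _ => ((hF j).2 u).1, Function.comp_apply, map_sum]
    exact Finset.sum_congr rfl fun j _ => ((hF j).2 u).2.symm

end Distribution

/-! ### Interpolation between the two block norms -/

section Interpolation
variable {X : Type*} [MeasurableSpace X] {μ : Measure X}

theorem tsum_int_eq_tsum_add_tsum_sub (h : ℤ → ℝ≥0∞) (N : ℤ) :
    ∑' j, h j = ∑' k : ℕ, h (N + (1 + k)) + ∑' k : ℕ, h (N - k) := by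
  rw [← (Equiv.addLeft (N + 1)).tsum_eq h,
    tsum_of_nat_of_neg_add_one ENNReal.summable ENNReal.summable]
  congr 1 <;> refine tsum_congr fun k => ?_ <;> congr 1 <;> simp only [Equiv.coe_addLeft] <;> ring

theorem tsum_two_rpow_neg_mul_lt_top {α : ℝ} (hα : 0 < α) :
    ∑' k : ℕ, (2 : ℝ≥0∞) ^ (-(α * k)) < ⊤ := by
  have h : (2 : ℝ≥0∞) ^ (-α) < 1 :=
    ENNReal.rpow_lt_one_of_one_lt_of_neg ENNReal.one_lt_two (neg_lt_zero.2 hα)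
  have e : ∀ k : ℕ, (2 : ℝ≥0∞) ^ (-(α * k)) = ((2 : ℝ≥0∞) ^ (-α)) ^ k := fun k => by
    rw [← ENNReal.rpow_natCast, ← ENNReal.rpow_mul, neg_mul]
  simp only [e, ENNReal.tsum_geometric]
  exact ENNReal.inv_lt_top.2 (tsub_pos_of_lt h)

theorem le_eLpNorm_count {r : ℝ≥0∞} (hr : r ≠ 0) (a : ℤ → ℝ≥0∞) (j : ℤ) :
    a j ≤ eLpNorm a r Measure.count := by
  rcases eq_or_ne r ⊤ with rfl | hrt
  · simp only [eLpNorm_exponent_top, eLpNormEssSup_count, enorm_eq_self]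
    exact le_iSup a j
  · have hr' : 0 < r.toReal := ENNReal.toReal_pos hr hrt
    rw [eLpNorm_eq_lintegral_rpow_enorm_toReal hr hrt, one_div, ENNReal.le_rpow_inv_iff hr',
      lintegral_count]
    simp only [enorm_eq_self]
    exact ENNReal.le_tsum (f := fun j => a j ^ r.toReal) j

theorem ofReal_rpow_eq_ofReal_exp {x : ℝ} (hx : 0 < x) (y : ℝ) :
    ENNReal.ofReal x ^ y = ENNReal.ofReal (Real.exp (Real.log x * y)) := by
  rw [ENNReal.ofReal_rpow_of_pos hx, Real.rpow_def_of_pos hx]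

theorem two_rpow_eq_ofReal_exp (y : ℝ) :
    (2 : ℝ≥0∞) ^ y = ENNReal.ofReal (Real.exp (Real.log 2 * y)) := by
  rw [← ofReal_rpow_eq_ofReal_exp two_pos, ENNReal.ofReal_ofNat]

theorem two_rpow_ne_zero (y : ℝ) : (2 : ℝ≥0∞) ^ y ≠ 0 := by
  simp

theorem two_rpow_ne_top (y : ℝ) : (2 : ℝ≥0∞) ^ y ≠ ⊤ := by
  simp

theorem eLpNorm_tsum_enorm_le {F : ℕ → X → ℂ} (hF : ∀ k, AEStronglyMeasurable (F k) μ)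
    {q : ℝ≥0∞} (hq : 1 ≤ q) :
    eLpNorm (fun x => ∑' k, ‖F k x‖ₑ) q μ ≤ ∑' k, eLpNorm (F k) q μ :=
  (eLpNorm_tsum_le (fun k => (hF k).enorm) hq).trans_eq
    (tsum_congr fun k => eLpNorm_enorm (F k))

/-- The Lorentz bound before optimizing over the scale `l`. With `δ = 1/q₁ - 1/q₀`, the series is
cut at the index `N` for which `s^δ ≈ l 2^{N(α+β)}`; the high frequencies are measured in `L^{q₀}`
and the low ones in `L^{q₁}`. Both contributions are then convolutions of a geometric sequence with
a weighted sequence of block norms. -/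
theorem lorentzNorm_le_of_splitting {F : ℤ → X → ℂ} (hF : ∀ j, AEStronglyMeasurable (F j) μ)
    {g : X → ℂ} (hg : ∀ᵐ x ∂μ, ‖g x‖ₑ ≤ ∑' j, ‖F j x‖ₑ) {α β : ℝ} (hα : 0 < α) (hβ : 0 < β)
    {q₀ q₁ : ℝ≥0∞} (hq₀ : 1 ≤ q₀) (hq₁ : 1 ≤ q₁) {a : ℝ} (ha : a ≠ 0)
    (ha' : (q₁⁻¹).toReal - (q₀⁻¹).toReal = a * ((α + β) * Real.log 2))
    {θ : ℝ} (hθ : θ = α / (α + β))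
    {p : ℝ} (hp : 1 / p = (1 - θ) * (q₀⁻¹).toReal + θ * (q₁⁻¹).toReal)
    {r : ℝ≥0∞} (hr : 1 ≤ r) {l : ℝ} (hl : 0 < l) :
    lorentzNorm μ p r g ≤ ENNReal.ofReal (Real.exp |a|⁻¹) ^ (1 / r.toReal) *
      (4 * ENNReal.ofReal l ^ θ * (∑' k : ℕ, (2 : ℝ≥0∞) ^ (-(α * k))) *
          eLpNorm (fun j : ℤ => (2 : ℝ≥0∞) ^ ((j : ℝ) * α) * eLpNorm (F j) q₀ μ) r Measure.count
        + 4 * ENNReal.ofReal l ^ (θ - 1) * (∑' k : ℕ, (2 : ℝ≥0∞) ^ (-(β * k))) *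
          eLpNorm (fun j : ℤ => (2 : ℝ≥0∞) ^ ((j : ℝ) * -β) * eLpNorm (F j) q₁ μ)
            r Measure.count) := by
  have hc : 0 < (α + β) * Real.log 2 := mul_pos (by linarith) (Real.log_pos one_lt_two)
  have hθα : θ * (α + β) = α := by rw [hθ]; field_simp
  have hθβ : (1 - θ) * (α + β) = β := by rw [sub_mul, hθα]; ring
  set b : ℝ := -(Real.log l / ((α + β) * Real.log 2)) with hb
  set A : ℤ → ℝ≥0∞ := fun j => (2 : ℝ≥0∞) ^ ((j : ℝ) * α) * eLpNorm (F j) q₀ μ with hA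
  set B : ℤ → ℝ≥0∞ := fun j => (2 : ℝ≥0∞) ^ ((j : ℝ) * -β) * eLpNorm (F j) q₁ μ with hB
  let H₀ : ℤ → ℝ≥0∞ := fun N =>
    ∑' k : ℕ, 4 * ENNReal.ofReal l ^ θ * (2 : ℝ≥0∞) ^ (-(α * k)) *
      A (Equiv.addRight (1 + (k : ℤ)) N)
  let H₁ : ℤ → ℝ≥0∞ := fun N =>
    ∑' k : ℕ, 4 * ENNReal.ofReal l ^ (θ - 1) * (2 : ℝ≥0∞) ^ (-(β * k)) *
      B (Equiv.subRight (k : ℤ) N)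
  have hH : ∀ s : ℝ, 0 < s → ENNReal.ofReal s ^ (1 / p) * rearrangement μ g (ENNReal.ofReal s)
      ≤ (H₀ + H₁) ⌊a * Real.log s + b⌋ := by
    intro s hs
    set N : ℤ := ⌊a * Real.log s + b⌋ with hN
    have hs0 : ENNReal.ofReal s ≠ 0 := (ENNReal.ofReal_pos.2 hs).ne'
    have hN0 : (N : ℝ) ≤ a * Real.log s + b := Int.floor_le _
    have hN1 : a * Real.log s + b < N + 1 := Int.lt_floor_add_one _
    have hlog : ((q₁⁻¹).toReal - (q₀⁻¹).toReal) * Real.log s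
        = (α + β) * Real.log 2 * (a * Real.log s + b) + Real.log l := by
      rw [ha', hb]; field_simp; ring
    have hl2 := Real.log_pos one_lt_two
    -- The exponent on the left is `θ δ log s`, and `θ (α + β) = α`.
    have key₀ : ENNReal.ofReal s ^ (1 / p) * ENNReal.ofReal s ^ (-(q₀⁻¹).toReal)
        ≤ ENNReal.ofReal l ^ θ * (2 : ℝ≥0∞) ^ (α * (N + 1)) := by
      rw [← ENNReal.rpow_add _ _ hs0 ENNReal.ofReal_ne_top, ofReal_rpow_eq_ofReal_exp hs,
        ofReal_rpow_eq_ofReal_exp hl, two_rpow_eq_ofReal_exp,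
        ← ENNReal.ofReal_mul (Real.exp_pos _).le, ← Real.exp_add]
      refine ENNReal.ofReal_le_ofReal (Real.exp_le_exp.2 ?_)
      calc Real.log s * (1 / p + -(q₀⁻¹).toReal)
          = θ * (((q₁⁻¹).toReal - (q₀⁻¹).toReal) * Real.log s) := by rw [hp]; ring
        _ = θ * (α + β) * Real.log 2 * (a * Real.log s + b) + Real.log l * θ := by
            rw [hlog]; ring
        _ = Real.log l * θ + Real.log 2 * α * (a * Real.log s + b) := by rw [hθα]; ring
        _ ≤ Real.log l * θ + Real.log 2 * α * (N + 1) := by gcongr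
        _ = _ := by ring
    -- The exponent on the left is `-(1 - θ) δ log s`, and `(1 - θ) (α + β) = β`.
    have key₁ : ENNReal.ofReal s ^ (1 / p) * ENNReal.ofReal s ^ (-(q₁⁻¹).toReal)
        ≤ ENNReal.ofReal l ^ (θ - 1) * (2 : ℝ≥0∞) ^ (-(β * N)) := by
      rw [← ENNReal.rpow_add _ _ hs0 ENNReal.ofReal_ne_top, ofReal_rpow_eq_ofReal_exp hs,
        ofReal_rpow_eq_ofReal_exp hl, two_rpow_eq_ofReal_exp,
        ← ENNReal.ofReal_mul (Real.exp_pos _).le, ← Real.exp_add]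
      refine ENNReal.ofReal_le_ofReal (Real.exp_le_exp.2 ?_)
      calc Real.log s * (1 / p + -(q₁⁻¹).toReal)
          = -(1 - θ) * (((q₁⁻¹).toReal - (q₀⁻¹).toReal) * Real.log s) := by rw [hp]; ring
        _ = Real.log l * (θ - 1)
            - (1 - θ) * (α + β) * Real.log 2 * (a * Real.log s + b) := by rw [hlog]; ring
        _ = Real.log l * (θ - 1) - Real.log 2 * β * (a * Real.log s + b) := by rw [hθβ]; ring
        _ ≤ Real.log l * (θ - 1) - Real.log 2 * β * N := by gcongr
        _ = _ := by ring
    have hsplit : ∀ᵐ x ∂μ, ‖g x‖ₑ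
        ≤ ∑' k : ℕ, ‖F (N + (1 + k)) x‖ₑ + ∑' k : ℕ, ‖F (N - k) x‖ₑ := by
      filter_upwards [hg] with x hx
      rwa [tsum_int_eq_tsum_add_tsum_sub _ N] at hx
    have hre := rearrangement_le (AEMeasurable.tsum fun k : ℕ => (hF (N + (1 + k))).enorm)
      (AEMeasurable.tsum fun k : ℕ => (hF (N - k)).enorm) hsplit hq₀ hq₁ hs0 ENNReal.ofReal_ne_top
    calc ENNReal.ofReal s ^ (1 / p) * rearrangement μ g (ENNReal.ofReal s)
        ≤ ENNReal.ofReal s ^ (1 / p) *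
          (4 * (ENNReal.ofReal s ^ (-(q₀⁻¹).toReal) * ∑' k : ℕ, eLpNorm (F (N + (1 + k))) q₀ μ
            + ENNReal.ofReal s ^ (-(q₁⁻¹).toReal) * ∑' k : ℕ, eLpNorm (F (N - k)) q₁ μ)) := by
          gcongr
          refine hre.trans ?_
          gcongr
          · exact eLpNorm_tsum_enorm_le (fun k : ℕ => hF (N + (1 + k))) hq₀
          · exact eLpNorm_tsum_enorm_le (fun k : ℕ => hF (N - k)) hq₁
      _ = 4 * (ENNReal.ofReal s ^ (1 / p) * ENNReal.ofReal s ^ (-(q₀⁻¹).toReal))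
            * ∑' k : ℕ, eLpNorm (F (N + (1 + k))) q₀ μ
          + 4 * (ENNReal.ofReal s ^ (1 / p) * ENNReal.ofReal s ^ (-(q₁⁻¹).toReal))
            * ∑' k : ℕ, eLpNorm (F (N - k)) q₁ μ := by ring
      _ ≤ 4 * (ENNReal.ofReal l ^ θ * (2 : ℝ≥0∞) ^ (α * (N + 1)))
            * ∑' k : ℕ, eLpNorm (F (N + (1 + k))) q₀ μ
          + 4 * (ENNReal.ofReal l ^ (θ - 1) * (2 : ℝ≥0∞) ^ (-(β * N)))
            * ∑' k : ℕ, eLpNorm (F (N - k)) q₁ μ := by gcongr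
      _ = (H₀ + H₁) N := by
          simp only [H₀, H₁, Pi.add_apply, ← ENNReal.tsum_mul_left]
          congr 1 <;> refine tsum_congr fun k => ?_
          · simp only [hA, Equiv.coe_addRight]
            rw [show α * ((N : ℝ) + 1) = -(α * k) + ((N + (1 + (k : ℤ)) : ℤ) : ℝ) * α by
              push_cast; ring, ENNReal.rpow_add _ _ two_ne_zero ENNReal.ofNat_ne_top]
            ring
          · simp only [hB, Equiv.subRight_apply]
            rw [show -(β * (N : ℝ)) = -(β * k) + ((N - (k : ℤ) : ℤ) : ℝ) * -β by
              push_cast; ring, ENNReal.rpow_add _ _ two_ne_zero ENNReal.ofNat_ne_top]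
            ring
  refine (lorentzNorm_le_of_floor_log ha hr hH).trans ?_
  gcongr
  refine (eLpNorm_add_le (measurable_of_countable _).aestronglyMeasurable
    (measurable_of_countable _).aestronglyMeasurable hr).trans ?_
  gcongr
  · refine (eLpNorm_count_tsum_mul_le hr _ A fun k => Equiv.addRight (1 + (k : ℤ))).trans_eq ?_
    rw [ENNReal.tsum_mul_left]
  · refine (eLpNorm_count_tsum_mul_le hr _ B fun k => Equiv.subRight (k : ℤ)).trans_eq ?_
    rw [ENNReal.tsum_mul_left]

/-- If the weighted block norms vanish for one pair of parameters, all blocks vanish almost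
everywhere, so that they vanish for any other pair. -/
theorem eLpNorm_count_eq_zero_of_eLpNorm_count_eq_zero {F : ℤ → X → ℂ}
    (hF : ∀ j, AEStronglyMeasurable (F j) μ) {q q' r : ℝ≥0∞} (hq : q ≠ 0) (hr : r ≠ 0) {s s' : ℝ}
    (h : eLpNorm (fun j : ℤ => (2 : ℝ≥0∞) ^ ((j : ℝ) * s) * eLpNorm (F j) q μ) r Measure.count
      = 0) :
    eLpNorm (fun j : ℤ => (2 : ℝ≥0∞) ^ ((j : ℝ) * s') * eLpNorm (F j) q' μ) r Measure.count
      = 0 := by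
  have h0 : ∀ j, eLpNorm (F j) q' μ = 0 := fun j => by
    have hj := (le_eLpNorm_count hr _ j).trans_eq h
    have hj' : eLpNorm (F j) q μ = 0 :=
      (mul_eq_zero.1 (le_bot_iff.1 hj)).resolve_left (two_rpow_ne_zero _)
    rw [eLpNorm_congr_ae ((eLpNorm_eq_zero_iff (hF j) hq).1 hj'), eLpNorm_zero]
  simp only [h0, mul_zero]
  exact eLpNorm_zero'

/-- The scale `B / A` gives the two terms of `lorentzNorm_le_of_splitting` the same size. -/
theorem div_rpow_mul_eq_rpow_mul_rpow {A B : ℝ≥0∞} (hA : A ≠ 0) (hA' : A ≠ ⊤) (hB : B ≠ 0)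
    (hB' : B ≠ ⊤) (θ : ℝ) :
    (B / A) ^ θ * A = A ^ (1 - θ) * B ^ θ ∧ (B / A) ^ (θ - 1) * B = A ^ (1 - θ) * B ^ θ := by
  have e : ∀ y : ℝ, (B / A) ^ y = A ^ (-y) * B ^ y := fun y => by
    rw [div_eq_mul_inv, ENNReal.mul_rpow_of_ne_top hB' (ENNReal.inv_ne_top.2 hA),
      ENNReal.inv_rpow, ENNReal.rpow_neg, mul_comm]
  constructor
  · rw [e, sub_eq_neg_add, ENNReal.rpow_add _ _ hA hA', ENNReal.rpow_one]; ring
  · rw [e, ENNReal.rpow_sub _ _ hB hB', ENNReal.rpow_one, neg_sub, mul_assoc,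
      ENNReal.div_mul_cancel hB hB']

/-- Real interpolation by the `J`-method: if `2^{jα} ‖F_j‖_{q₀}` and `2^{-jβ} ‖F_j‖_{q₁}` are in
`ℓ^r`, then any function dominated by `∑ |F_j|` is in `L^{p,r}`, with a multiplicative bound. -/
theorem lorentzNorm_le_interpolation {F : ℤ → X → ℂ} (hF : ∀ j, AEStronglyMeasurable (F j) μ)
    {g : X → ℂ} (hg : ∀ᵐ x ∂μ, ‖g x‖ₑ ≤ ∑' j, ‖F j x‖ₑ) {α β : ℝ} (hα : 0 < α) (hβ : 0 < β)
    {q₀ q₁ : ℝ≥0∞} (hq₀ : 1 ≤ q₀) (hq₁ : 1 ≤ q₁) {a : ℝ} (ha : a ≠ 0)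
    (ha' : (q₁⁻¹).toReal - (q₀⁻¹).toReal = a * ((α + β) * Real.log 2))
    {θ : ℝ} (hθ : θ = α / (α + β))
    {p : ℝ} (hp : 1 / p = (1 - θ) * (q₀⁻¹).toReal + θ * (q₁⁻¹).toReal)
    {r : ℝ≥0∞} (hr : 1 ≤ r) {A B : ℝ≥0∞}
    (hA : eLpNorm (fun j : ℤ => (2 : ℝ≥0∞) ^ ((j : ℝ) * α) * eLpNorm (F j) q₀ μ) r Measure.count
      = A)
    (hB : eLpNorm (fun j : ℤ => (2 : ℝ≥0∞) ^ ((j : ℝ) * -β) * eLpNorm (F j) q₁ μ) r Measure.count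
      = B) (hA' : A ≠ ⊤) (hB' : B ≠ ⊤) :
    lorentzNorm μ p r g ≤ ENNReal.ofReal (Real.exp |a|⁻¹) ^ (1 / r.toReal) *
      (4 * (∑' k : ℕ, (2 : ℝ≥0∞) ^ (-(α * k)) + ∑' k : ℕ, (2 : ℝ≥0∞) ^ (-(β * k)))) *
        A ^ (1 - θ) * B ^ θ := by
  have hr0 : r ≠ 0 := (zero_lt_one.trans_le hr).ne'
  have main := fun l hl => lorentzNorm_le_of_splitting hF hg hα hβ hq₀ hq₁ ha ha' hθ hp hr
    (l := l) hl
  rw [hA, hB] at main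
  -- The ratio `B / A` is not a scale if `A` or `B` vanishes; then both do, and any scale works.
  by_cases h0 : A = 0
  · have h1 : B = 0 := hB ▸ eLpNorm_count_eq_zero_of_eLpNorm_count_eq_zero hF
      (zero_lt_one.trans_le hq₀).ne' hr0 (hA.trans h0)
    have := main 1 one_pos
    simp only [h0, h1, mul_zero, add_zero] at this
    exact this.trans bot_le
  by_cases h1 : B = 0
  · exact absurd (hA ▸ eLpNorm_count_eq_zero_of_eLpNorm_count_eq_zero hF
      (zero_lt_one.trans_le hq₁).ne' hr0 (hB.trans h1)) h0
  have hdiv : B / A ≠ ⊤ := ENNReal.div_ne_top hB' h0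
  have hl : 0 < (B / A).toReal := ENNReal.toReal_pos (ENNReal.div_ne_zero.2 ⟨h1, hA'⟩) hdiv
  refine (main _ hl).trans_eq ?_
  obtain ⟨e₀, e₁⟩ := div_rpow_mul_eq_rpow_mul_rpow h0 hA' h1 hB' θ
  rw [ENNReal.ofReal_toReal hdiv]
  set W₀ := ∑' k : ℕ, (2 : ℝ≥0∞) ^ (-(α * k))
  set W₁ := ∑' k : ℕ, (2 : ℝ≥0∞) ^ (-(β * k))
  set K := ENNReal.ofReal (Real.exp |a|⁻¹) ^ (1 / r.toReal)
  calc K * (4 * (B / A) ^ θ * W₀ * A + 4 * (B / A) ^ (θ - 1) * W₁ * B)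
      = K * (4 * W₀ * ((B / A) ^ θ * A) + 4 * W₁ * ((B / A) ^ (θ - 1) * B)) := by ring
    _ = _ := by rw [e₀, e₁]; ring

end Interpolation

/-! ### Besov norms as sequence norms -/

section Besov
variable {n : ℕ}

theorem besovNorm_eq_eLpNorm_count (φ : EuclideanSpace ℝ (Fin n) → ℝ) (s : ℝ) (p : ℝ≥0∞)
    {r : ℝ≥0∞} (hr : r ≠ 0) (f : 𝓢'(EuclideanSpace ℝ (Fin n), ℂ)) :
    besovNorm φ s p r f = eLpNorm (fun j : ℤ => (2 : ℝ≥0∞) ^ ((j : ℝ) * s) *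
      distLpNorm p (dyadicBlock φ j f)) r Measure.count := by
  unfold besovNorm
  split_ifs with hrt
  · simp [hrt]
  · simp [eLpNorm_eq_lintegral_rpow_enorm_toReal hr hrt, lintegral_count]

theorem tsum_eLpNorm_lt_top {X : Type*} [MeasurableSpace X] {μ : Measure X} {F : ℕ → X → ℂ}
    {q A : ℝ≥0∞} {α : ℝ} (hα : 0 < α) (hA : A ≠ ⊤)
    (h : ∀ k : ℕ, (2 : ℝ≥0∞) ^ (α * k) * eLpNorm (F k) q μ ≤ A) :
    ∑' k, eLpNorm (F k) q μ < ⊤ := by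
  calc ∑' k, eLpNorm (F k) q μ ≤ ∑' k : ℕ, (2 : ℝ≥0∞) ^ (-(α * k)) * A := by
        refine ENNReal.tsum_le_tsum fun k => ?_
        rw [ENNReal.rpow_neg, mul_comm, ← div_eq_mul_inv,
          ENNReal.le_div_iff_mul_le (.inl (two_rpow_ne_zero _)) (.inl (two_rpow_ne_top _)),
          mul_comm]
        exact h k
    _ < ⊤ := by
        rw [ENNReal.tsum_mul_right]
        exact ENNReal.mul_lt_top (tsum_two_rpow_neg_mul_lt_top hα) hA.lt_top

end Besov
end RefinedSobolev

theorem theorem2 (n : ℕ) (φ : EuclideanSpace ℝ (Fin n) → ℝ) (hφ : RefinedSobolev.IsCutoff φ)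
    (α β : ℝ) (hα : 0 < α) (hβ : 0 < β)
    (q₀ q₁ : ℝ≥0∞) (hq₀ : 1 ≤ q₀) (hq₁ : 1 ≤ q₁) (hq : q₀ ≠ q₁)
    (θ : ℝ) (hθ : θ = α / (α + β))
    (p : ℝ) (hp : 1 / p = (1 - θ) * (q₀⁻¹).toReal + θ * (q₁⁻¹).toReal)
    (r : ℝ≥0∞) (hr : 1 ≤ r) :
    ∃ C : ℝ≥0, ∀ f : 𝓢'(EuclideanSpace ℝ (Fin n), ℂ),
      RefinedSobolev.HasLittlewoodPaley φ f →
      RefinedSobolev.besovNorm φ α q₀ r f < ⊤ →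
      RefinedSobolev.besovNorm φ (-β) q₁ r f < ⊤ →
      ∃ g : EuclideanSpace ℝ (Fin n) → ℂ,
        RefinedSobolev.IsFunction f g ∧
        RefinedSobolev.lorentzNorm volume p r g < ⊤ ∧
        RefinedSobolev.lorentzNorm volume p r g ≤
          (C : ℝ≥0∞) * RefinedSobolev.besovNorm φ α q₀ r f ^ (1 - θ)
            * RefinedSobolev.besovNorm φ (-β) q₁ r f ^ θ := by
  open RefinedSobolev in
  have hr0 : r ≠ 0 := (zero_lt_one.trans_le hr).ne'
  have hq₀0 : q₀ ≠ 0 := (zero_lt_one.trans_le hq₀).ne'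
  have hq₁0 : q₁ ≠ 0 := (zero_lt_one.trans_le hq₁).ne'
  have hc : 0 < (α + β) * Real.log 2 := mul_pos (by linarith) (Real.log_pos one_lt_two)
  have hδ : (q₁⁻¹).toReal - (q₀⁻¹).toReal ≠ 0 := fun h => hq <| by
    have := (ENNReal.toReal_eq_toReal_iff' (ENNReal.inv_ne_top.2 hq₁0)
      (ENNReal.inv_ne_top.2 hq₀0)).1 (sub_eq_zero.1 h)
    exact (inv_injective this).symm
  have ha := div_ne_zero hδ hc.ne'
  have ha' := (div_mul_cancel₀ ((q₁⁻¹).toReal - (q₀⁻¹).toReal) hc.ne').symm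
  set a := ((q₁⁻¹).toReal - (q₀⁻¹).toReal) / ((α + β) * Real.log 2)
  have hθ0 : 0 ≤ θ := by rw [hθ]; positivity
  have hθ1 : 0 ≤ 1 - θ := by
    rw [hθ, one_sub_div (by positivity), add_sub_cancel_left]; positivity
  obtain ⟨C, hC⟩ : ∃ C : ℝ≥0, (C : ℝ≥0∞) = ENNReal.ofReal (Real.exp |a|⁻¹) ^ (1 / r.toReal) *
      (4 * (∑' k : ℕ, (2 : ℝ≥0∞) ^ (-(α * k)) + ∑' k : ℕ, (2 : ℝ≥0∞) ^ (-(β * k)))) := by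
    refine ⟨_, ENNReal.coe_toNNReal (ENNReal.mul_ne_top
      (ENNReal.rpow_ne_top_of_nonneg (by positivity) ENNReal.ofReal_ne_top)
      (ENNReal.mul_ne_top ENNReal.ofNat_ne_top (ENNReal.add_ne_top.2
        ⟨(tsum_two_rpow_neg_mul_lt_top hα).ne, (tsum_two_rpow_neg_mul_lt_top hβ).ne⟩)))⟩
  refine ⟨C, fun f hf hA hB => ?_⟩
  rw [besovNorm_eq_eLpNorm_count φ _ _ hr0] at hA hB ⊢
  rw [besovNorm_eq_eLpNorm_count φ _ _ hr0]
  -- Each block is a function, and the same one for both exponents.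
  have hfun : ∀ j : ℤ, ∃ F, IsFunction (dyadicBlock φ j f) F := fun j => by
    refine exists_isFunction_of_distLpNorm_lt_top (p := q₀) ?_
    have hj := (le_eLpNorm_count hr0 _ j).trans_lt hA
    exact lt_top_iff_ne_top.2 fun htop => by
      simp [htop, ENNReal.mul_top (two_rpow_ne_zero _)] at hj
  choose F hF using hfun
  simp only [(hF _).distLpNorm_eq] at hA hB ⊢
  have hFm : ∀ j, AEStronglyMeasurable (F j) volume := fun j => (hF j).1
  -- Cut at `0`, the series converges absolutely in `L^{q₀}` upwards and in `L^{q₁}` downwards.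
  have hsum₀ : ∑' k : ℕ, eLpNorm (F (0 + (1 + k))) q₀ volume < ⊤ := by
    refine tsum_eLpNorm_lt_top hα hA.ne fun k => ?_
    refine le_trans ?_ (le_eLpNorm_count hr0 _ (0 + (1 + (k : ℤ))))
    refine mul_le_mul_left (ENNReal.rpow_le_rpow_of_exponent_le ENNReal.one_lt_two.le ?_) _
    push_cast; nlinarith
  have hsum₁ : ∑' k : ℕ, eLpNorm (F (0 - k)) q₁ volume < ⊤ := by
    refine tsum_eLpNorm_lt_top hβ hB.ne fun k => ?_
    refine le_trans (le_of_eq ?_) (le_eLpNorm_count hr0 _ (0 - (k : ℤ)))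
    congr 2
    push_cast; ring
  have hsplit := fun x => tsum_int_eq_tsum_add_tsum_sub (fun j => ‖F j x‖ₑ) 0
  have hfin : ∀ᵐ x : EuclideanSpace ℝ (Fin n), ∑' j, ‖F j x‖ₑ < ⊤ := by
    filter_upwards [ae_lt_top_of_eLpNorm_lt_top (AEMeasurable.tsum fun k : ℕ =>
        (hFm (0 + (1 + k))).enorm) hq₀0
        ((eLpNorm_tsum_enorm_le (fun k : ℕ => hFm (0 + (1 + k))) hq₀).trans_lt hsum₀),
      ae_lt_top_of_eLpNorm_lt_top (AEMeasurable.tsum fun k : ℕ => (hFm (0 - k)).enorm) hq₁0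
        ((eLpNorm_tsum_enorm_le (fun k : ℕ => hFm (0 - k)) hq₁).trans_lt hsum₁)] with x h₀ h₁
    rw [hsplit]
    exact ENNReal.add_lt_top.2 ⟨h₀, h₁⟩
  have hint : ∀ u : 𝓢(EuclideanSpace ℝ (Fin n), ℂ),
      ∫⁻ x, ‖u x‖ₑ * ∑' j, ‖F j x‖ₑ < ⊤ := fun u => by
    simp only [hsplit, mul_add]
    rw [lintegral_add_left' (f := fun x => ‖u x‖ₑ * ∑' k : ℕ, ‖F (0 + (1 + k)) x‖ₑ)
      (u.continuous.aestronglyMeasurable.enorm.mul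
        (AEMeasurable.tsum fun k : ℕ => (hFm (0 + (1 + k))).enorm))]
    exact ENNReal.add_lt_top.2
      ⟨lintegral_enorm_mul_tsum_lt_top (fun k : ℕ => hFm (0 + (1 + k))) hq₀ hsum₀ u,
        lintegral_enorm_mul_tsum_lt_top (fun k : ℕ => hFm (0 - k)) hq₁ hsum₁ u⟩
  have hle := lorentzNorm_le_interpolation (g := fun x => ∑' j, F j x) hFm
    (hfin.mono fun x hx => enorm_tsum_le_tsum_enorm) hα hβ hq₀ hq₁ ha ha' hθ hp hr rfl rfl
    hA.ne hB.ne
  rw [← hC] at hle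
  refine ⟨fun x => ∑' j, F j x, isFunction_tsum hF hf hfin hint, hle.trans_lt ?_, hle⟩
  exact ENNReal.mul_lt_top (ENNReal.mul_lt_top ENNReal.coe_lt_top
    (ENNReal.rpow_lt_top_of_nonneg hθ1 hA.ne)) (ENNReal.rpow_lt_top_of_nonneg hθ0 hB.ne)
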